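/- Let $\mathfrak h_n$ be the Siegel upper half-space of symmetric complex $n\times n$ matrices with positive definite imaginary part, on which $\mathrm{Sp}(2n,\mathbb R)$ (matrices in $n\times n$ blocks) acts by $\left(\begin{smallmatrix}A&B\\C&D\end{smallmatrix}\right)Z=(AZ+B)(CZ+D)^{-1}$. Let $\tau(Z)=-\overline Z$ on $\mathfrak h_n$ and $\tilde g=\tau(g)=I_-gI_-$ on $\mathrm{Sp}(2n)$, where $I_-=\left(\begin{smallmatrix}-I&0\\0&I\end{smallmatrix}\right)$, and for $\omega\in \mathrm{Sp}(2n,\mathbb Z)$ put $\mathfrak h_n^{\omega}=\{Z\in\mathfrak h_n\mid \omega Z=\tau(Z)\}$. Let $\overline{\mathfrak h}_n$ be the Satake partial compactification of $\mathfrak h_n$, i.e. the union of all its rational boundary components with the Satake topology; the action of $\mathrm{Sp}(2n,\mathbb Q)$ and the involution $\tau$ extend to $\overline{\mathfrak h}_n$. For $0\le q\le n$ let $F_q\cong\mathfrak h_q$ be the standard boundary component of rank $q$, consisting of the points $\lim_{Y\to\infty}\left(\begin{smallmatrix}Z&0\\0&iY\end{smallmatrix}\right)$, $Z\in\mathfrak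 h_q$ (so $F_n=\mathfrak h_n$); the rational boundary components of rank $q$ are the translates of $F_q$ by $\mathrm{Sp}(2n,\mathbb Q)$. The normalizer $P_q$ of $F_q$ consists of the symplectic matrices of the form $$\begin{pmatrix}A&0&B&*\\ *&*&*&*\\ C&0&D&*\\ 0&0&0&*\end{pmatrix}$$ with respect to block sizes $q,n-q,q,n-q$, and $\nu:P_q\to \mathrm{Sp}(2q)$ sends this matrix to $\left(\begin{smallmatrix}A&B\\C&D\end{smallmatrix}\right)$. For a rational boundary component $F$ and $\gamma\in\mathrm{Sp}(2n,\mathbb Z)$ put $F^\gamma=\{x\in F\mid \tau(x)=\gamma x\}$. Fix $m\ge1$ and let $\Gamma(4m)$ be the principal congruence subgroup of level $4m$ of $\mathrm{Sp}(2n,\mathbb Z)$. Let $\pi:\overline{\mathfrak h}_n\to V=\Gamma(4m)\backslash\overline{\mathfrak h}_n$ be the projection to the Baily-Borel compactification of $X=\Gamma(4m)\backslash\mathfrak h_n$, let $V_{\mathbb R}$ be the fixed point set of the involution of $V$ induced by $\tau$, let $X_{\mathbb R}=X\cap V_{\mathbb R}$, and let $\overline X_{\mathbb R}$ be the closure of $X_{\mathbb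 R}$ in $V_{\mathbb R}$. A $\Gamma(4m)$-real boundary pair $(F,\gamma)$ of rank $q$ consists of a rational boundary component $F$ of rank $q$ and an element $\gamma\in\Gamma(4m)$ such that $F^\gamma\neq\emptyset$. For $0\le r\le n$ and $s=n-r$ let $$j_r=\begin{pmatrix}I_r&0&0&0\\0&0&0&I_s\\0&0&I_r&0\\0&-I_s&0&0\end{pmatrix}\in\mathrm{Sp}(2n,\mathbb Z).$$ **Proposition.** Let $0\le q\le n$, let $(F,\gamma)$ be a $\Gamma(4m)$-real boundary pair of rank $q$, and let $g\in\mathrm{Sp}(2n,\mathbb Z)$ be such that $g(F_q)=F$ and $u=\tilde g^{-1}\gamma g\in\ker(\nu)$. Suppose that $q\le r\le n$ and $j_r\,u\,j_r\in\Gamma(4m)$. Define $\omega=\tau(gj_r)(gj_r)^{-1}$. Then $\omega\in\Gamma(4m)$ and $$F^\gamma=F^\omega\subset\overline{\mathfrak h_n^{\omega}},$$ where the closure is taken in $\overline{\mathfrak h}_n$. Consequently $\pi(F^\gamma)$ is contained in $\overline X_{\mathbb R}$. -/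

import Mathlib

open Matrix Topology

namespace Satake

/-! ### Symplectic groups, the involution `τ`, congruence subgroups -/

/-- The symplectic group `Sp(2n, R)`, written in `n × n` blocks `(A, B; C, D)`. -/
abbrev Sp (n : ℕ) (R : Type) [CommRing R] : Type :=
  Matrix.symplecticGroup (Fin n) R

/-- The matrix `I₋ = (-I, 0; 0, I)`. -/
def Iminus (n : ℕ) (R : Type) [CommRing R] : Matrix (Fin n ⊕ Fin n) (Fin n ⊕ Fin n) R :=
  Matrix.fromBlocks (-1) 0 0 1

theorem Iminus_mul_self (n : ℕ) (R : Type) [CommRing R] : Iminus n R * Iminus n R = 1 := by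
  simp [Iminus, Matrix.fromBlocks_multiply]

theorem Iminus_J (n : ℕ) (R : Type) [CommRing R] :
    Iminus n R * Matrix.J (Fin n) R * Iminus n R = -Matrix.J (Fin n) R := by
  simp [Iminus, Matrix.J, Matrix.fromBlocks_multiply, Matrix.fromBlocks_neg]

theorem Iminus_transpose (n : ℕ) (R : Type) [CommRing R] : (Iminus n R)ᵀ = Iminus n R := by
  simp [Iminus, Matrix.fromBlocks_transpose]

theorem tau_mem {n : ℕ} {R : Type} [CommRing R] (g : Sp n R) :
    Iminus n R * g.1 * Iminus n R ∈
    Matrix.symplecticGroup (Fin n) R := by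
  have hg := SymplecticGroup.mem_iff.mp g.2
  rw [SymplecticGroup.mem_iff, Matrix.transpose_mul, Matrix.transpose_mul, Iminus_transpose]
  calc Iminus n R * g.1 * Iminus n R * Matrix.J (Fin n) R *
        (Iminus n R * (g.1ᵀ * Iminus n R))
      = Iminus n R * (g.1 *
        (Iminus n R * Matrix.J (Fin n) R * Iminus n R) * g.1ᵀ) * Iminus n R := by
        simp only [Matrix.mul_assoc]
    _ = Matrix.J (Fin n) R := by
        rw [Iminus_J]
        simp only [Matrix.mul_neg, Matrix.neg_mul, hg]
        rw [Iminus_J, neg_neg]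

/-- The involution `τ(g) = I₋ g I₋`, i.e. `(A, B; C, D) ↦ (A, -B; -C, D)`, on `Sp(2n, R)`. -/
def tau {n : ℕ} {R : Type} [CommRing R] (g : Sp n R) : Sp n R :=
  ⟨Iminus n R * g.1 * Iminus n R, tau_mem g⟩

theorem coe_tau {n : ℕ} {R : Type} [CommRing R] (g : Sp n R) :
    (tau g : Matrix (Fin n ⊕ Fin n) (Fin n ⊕ Fin n) R) =
      Iminus n R * g.1 * Iminus n R := rfl

theorem coe_mapSp_mem {n : ℕ} {R S : Type} [CommRing R] [CommRing S] (f : R →+* S) (g : Sp n R) :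
    g.1.map f ∈ Matrix.symplecticGroup (Fin n) S :=
  SymplecticGroup.map_mem g.2 f

/-- The map `Sp(2n, R) → Sp(2n, S)` induced by a ring homomorphism, as a function. -/
def mapSpFun {n : ℕ} {R S : Type} [CommRing R] [CommRing S] (f : R →+* S) (g : Sp n R) : Sp n S :=
  ⟨g.1.map f, coe_mapSp_mem f g⟩

theorem mapSpFun_mul {n : ℕ} {R S : Type} [CommRing R] [CommRing S] (f : R →+* S)
    (g h : Sp n R) : mapSpFun f (g * h) = mapSpFun f g * mapSpFun f h := by
  apply Subtype.ext
  exact Matrix.map_mul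

/-- The homomorphism `Sp(2n, R) → Sp(2n, S)` induced by a ring homomorphism `R → S`. -/
def mapSp {n : ℕ} {R S : Type} [CommRing R] [CommRing S] (f : R →+* S) : Sp n R →* Sp n S :=
  MonoidHom.mk' (mapSpFun f) (mapSpFun_mul f)

theorem coe_mapSp {n : ℕ} {R S : Type} [CommRing R] [CommRing S] (f : R →+* S) (g : Sp n R) :
    (mapSp f g : Matrix (Fin n ⊕ Fin n) (Fin n ⊕ Fin n) S) = g.1.map f := rfl

/-- The principal congruence subgroup `Γ(N)` of `Sp(2n, ℤ)`:
the `γ` with `γ ≡ I` modulo `N`. -/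
def Gam (n N : ℕ) : Subgroup (Sp n ℤ) :=
  (mapSp (n := n) (Int.castRingHom (ZMod N))).ker

theorem tau_mapSp {n : ℕ} {R S : Type} [CommRing R] [CommRing S] (f : R →+* S) (g : Sp n R) :
    tau (mapSp f g) = mapSp f (tau g) := by
  have hI : (Iminus n R).map f = Iminus n S := by
    simp [Iminus, Matrix.fromBlocks_map, Matrix.map_neg]
  apply Subtype.ext
  rw [coe_tau, coe_mapSp, coe_mapSp, coe_tau, Matrix.map_mul, Matrix.map_mul, hI]

theorem tau_mem_Gam {n N : ℕ} {g : Sp n ℤ} (hg : g ∈ Gam n N) : tau g ∈ Gam n N := by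
  rw [Gam, MonoidHom.mem_ker] at hg ⊢
  rw [← tau_mapSp, hg]
  apply Subtype.ext
  rw [coe_tau, Submonoid.coe_one, Matrix.mul_one, Iminus_mul_self]

/-! ### The Siegel upper half-space -/

/-- The Siegel upper half-space `𝔥_q`. -/
def siegel (q : ℕ) : Set (Matrix (Fin q) (Fin q) ℂ) :=
  {Z | Zᵀ = Z ∧ (Z.map Complex.im).PosDef}

/-- The antiholomorphic involution `τ(Z) = -conj Z` on matrices. -/
def tauMat {q : ℕ} (Z : Matrix (Fin q) (Fin q) ℂ) : Matrix (Fin q) (Fin q) ℂ :=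
  Z.map fun z => -(starRingEnd ℂ z)

theorem tauMat_mem {q : ℕ} {Z : Matrix (Fin q) (Fin q) ℂ} (hZ : Z ∈ siegel q) :
    tauMat Z ∈ siegel q := by
  refine ⟨?_, ?_⟩
  · rw [tauMat, ← Matrix.transpose_map, hZ.1]
  · have : (tauMat Z).map Complex.im = Z.map Complex.im := by
      ext i j
      simp [tauMat]
    rw [this]
    exact hZ.2

/-- The fractional linear transformation `γ Z = (A Z + B) (C Z + D)⁻¹`. -/
noncomputable def moebius {n : ℕ} (γ : Sp n ℤ) (Z : Matrix (Fin n) (Fin n) ℂ) :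
    Matrix (Fin n) (Fin n) ℂ :=
  let M : Matrix (Fin n ⊕ Fin n) (Fin n ⊕ Fin n) ℂ := γ.1.map (Int.cast : ℤ → ℂ)
  (M.toBlocks₁₁ * Z + M.toBlocks₁₂) * (M.toBlocks₂₁ * Z + M.toBlocks₂₂)⁻¹

/-- The locus `𝔥_n^γ = {Z ∈ 𝔥_n | γ Z = τ(Z)}` of `γ`-real points. -/
def realLocus {n : ℕ} (γ : Sp n ℤ) : Set (siegel n) :=
  {Z | moebius γ Z = tauMat (Z : Matrix (Fin n) (Fin n) ℂ)}

/-! ### The Satake partial compactification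

A point `Z ∈ 𝔥_n` is identified with the Lagrangian subspace `{(Z b, b)}` of `ℂ^{2n}`, so that the
linear action of `Sp(2n)` on subspaces extends `Z ↦ (A Z + B) (C Z + D)⁻¹`.  For `Z ∈ 𝔥_q` the limit
of the points `(Z, 0; 0, iY)` of `𝔥_n` as `Y → ∞` is then a Lagrangian subspace too. -/

/-- The limit, as `Y → ∞`, of the Lagrangian subspaces attached to `(Z, 0; 0, iY)`,
where `Z` is a `q × q` matrix: the vectors `(a, b)` with `a_i = (Z b)_i` for `i < q` and `b_i = 0`
for `i ≥ q`.  For `q = n` it is the subspace `{(Z b, b)}` itself. -/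
def lagr {n q : ℕ} (hq : q ≤ n) (Z : Matrix (Fin q) (Fin q) ℂ) :
    Submodule ℂ (Fin n ⊕ Fin n → ℂ) where
  carrier := {v | (∀ i : Fin n, q ≤ (i : ℕ) → v (Sum.inr i) = 0) ∧
    ∀ i : Fin q, v (Sum.inl (Fin.castLE hq i)) = ∑ k, Z i k * v (Sum.inr (Fin.castLE hq k))}
  zero_mem' := by simp
  add_mem' := by
    rintro v w ⟨hv1, hv2⟩ ⟨hw1, hw2⟩
    refine ⟨fun i hi => by simp [hv1 i hi, hw1 i hi], fun i => ?_⟩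
    simp [hv2 i, hw2 i, mul_add, Finset.sum_add_distrib]
  smul_mem' := by
    rintro c v ⟨hv1, hv2⟩
    refine ⟨fun i hi => by simp [hv1 i hi], fun i => ?_⟩
    simp only [Pi.smul_apply, smul_eq_mul, hv2 i, Finset.mul_sum]
    exact Finset.sum_congr rfl fun k _ => by ring

/-- The action of `Sp(2n, ℚ)` on subspaces of `ℂ^{2n}`. -/
noncomputable def actL {n : ℕ} (g : Sp n ℚ) (L : Submodule ℂ (Fin n ⊕ Fin n → ℂ)) :
    Submodule ℂ (Fin n ⊕ Fin n → ℂ) :=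
  L.map ((g.1.map (Rat.castHom ℂ)).mulVecLin)

theorem actL_one {n : ℕ} (L : Submodule ℂ (Fin n ⊕ Fin n → ℂ)) : actL 1 L = L := by
  simp [actL]

theorem actL_mul {n : ℕ} (g h : Sp n ℚ) (L : Submodule ℂ (Fin n ⊕ Fin n → ℂ)) :
    actL (g * h) L = actL g (actL h L) := by
  simp only [actL, Submonoid.coe_mul, Matrix.map_mul, Matrix.mulVecLin_mul, Submodule.map_comp]

/-- The underlying set of the Satake partial compactification of `𝔥_n`: the union of all
rational boundary components, i.e. of the translates by `Sp(2n, ℚ)` of the standard boundary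
components `F_q ≅ 𝔥_q`, `0 ≤ q ≤ n` (where `F_n = 𝔥_n`). -/
def Hbar (n : ℕ) : Type :=
  {L : Submodule ℂ (Fin n ⊕ Fin n → ℂ) //
    ∃ (g : Sp n ℚ) (q : ℕ) (hq : q ≤ n) (Z : siegel q), L = actL g (lagr hq Z)}

noncomputable instance instActionRat (n : ℕ) : MulAction (Sp n ℚ) (Hbar n) where
  smul g x := ⟨actL g x.1, by
    obtain ⟨h, q, hq, Z, hx⟩ := x.2
    exact ⟨g * h, q, hq, Z, by rw [hx, actL_mul]⟩⟩
  one_smul x := Subtype.ext (actL_one x.1)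
  mul_smul g h x := Subtype.ext (actL_mul g h x.1)

/-- `Sp(2n, ℤ)` acts through `Sp(2n, ℤ) ⊆ Sp(2n, ℚ)`. -/
noncomputable instance instActionInt (n : ℕ) : MulAction (Sp n ℤ) (Hbar n) :=
  MulAction.compHom (Hbar n) (mapSp (n := n) (Int.castRingHom ℚ))

theorem int_smul_def {n : ℕ} (g : Sp n ℤ) (x : Hbar n) :
    g • x = mapSp (n := n) (Int.castRingHom ℚ) g • x := rfl

/-- The attaching map `φ : 𝔥_q → Hbar n`. -/
def phi {n q : ℕ} (hq : q ≤ n) (Z : siegel q) : Hbar n :=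
  ⟨lagr hq Z, 1, q, hq, Z, (actL_one _).symm⟩

/-- The inclusion of `𝔥_n` into its Satake partial compactification. -/
def incl {n : ℕ} (Z : siegel n) : Hbar n := phi le_rfl Z

/-- The standard boundary component `F_q`. -/
def stdF {n q : ℕ} (hq : q ≤ n) : Set (Hbar n) := Set.range (phi hq)

/-- The rational boundary components of rank `q`. -/
def IsRationalBoundaryComponent {n q : ℕ} (hq : q ≤ n) (F : Set (Hbar n)) : Prop :=
  ∃ g : Sp n ℚ, F = (fun x => g • x) '' stdF hq

/-! ### The involution `τ` on the partial compactification -/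

/-- The antilinear involution `v ↦ I₋ (conj v)` of `ℂ^{2n}`. -/
def tauVec {n : ℕ} (v : Fin n ⊕ Fin n → ℂ) : Fin n ⊕ Fin n → ℂ :=
  Iminus n ℂ *ᵥ star v

theorem tauVec_inl {n : ℕ} (v : Fin n ⊕ Fin n → ℂ) (i : Fin n) :
    tauVec v (Sum.inl i) = -star (v (Sum.inl i)) := by
  simp [tauVec, Iminus, Matrix.fromBlocks_mulVec, Matrix.neg_mulVec]

theorem tauVec_inr {n : ℕ} (v : Fin n ⊕ Fin n → ℂ) (i : Fin n) :
    tauVec v (Sum.inr i) = star (v (Sum.inr i)) := by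
  simp [tauVec, Iminus, Matrix.fromBlocks_mulVec]

theorem tauVec_tauVec {n : ℕ} (v : Fin n ⊕ Fin n → ℂ) : tauVec (tauVec v) = v := by
  funext i
  cases i with
  | inl i => simp [tauVec_inl]
  | inr i => simp [tauVec_inr]

/-- The image of a subspace under `tauVec` (equivalently, its preimage, `tauVec` being an
involution). -/
def tauL {n : ℕ} (L : Submodule ℂ (Fin n ⊕ Fin n → ℂ)) : Submodule ℂ (Fin n ⊕ Fin n → ℂ) where
  carrier := {v | tauVec v ∈ L}
  zero_mem' := by simp [tauVec]
  add_mem' := by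
    intro v w hv hw
    have : tauVec (v + w) = tauVec v + tauVec w := by simp [tauVec, Matrix.mulVec_add]
    simpa [this] using L.add_mem hv hw
  smul_mem' := by
    intro c v hv
    have : tauVec (c • v) = star c • tauVec v := by simp [tauVec, Matrix.mulVec_smul]
    simpa [this] using L.smul_mem (star c) hv

theorem mem_tauL {n : ℕ} {L : Submodule ℂ (Fin n ⊕ Fin n → ℂ)} {v : Fin n ⊕ Fin n → ℂ} :
    v ∈ tauL L ↔ tauVec v ∈ L := Iff.rfl

theorem tauVec_mulVec {n : ℕ} (g : Sp n ℚ) (v : Fin n ⊕ Fin n → ℂ) :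
    tauVec ((g.1.map (Rat.castHom ℂ)) *ᵥ v) =
      ((tau g).1.map (Rat.castHom ℂ)) *ᵥ tauVec v := by
  have hI : (Iminus n ℚ).map (Rat.castHom ℂ) = Iminus n ℂ := by
    simp [Iminus, Matrix.fromBlocks_map, Matrix.map_neg]
  have h1 : ((tau g).1.map (Rat.castHom ℂ)) =
      Iminus n ℂ * (g.1.map (Rat.castHom ℂ)) * Iminus n ℂ := by
    rw [coe_tau, Matrix.map_mul, Matrix.map_mul, hI]
  have h2 : star ((g.1.map (Rat.castHom ℂ)) *ᵥ v) =
      (g.1.map (Rat.castHom ℂ)) *ᵥ star v := by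
    funext i
    simp [Matrix.mulVec, dotProduct, star_sum]
  rw [tauVec, h2, h1, tauVec, Matrix.mulVec_mulVec, Matrix.mulVec_mulVec]
  congr 1
  rw [Matrix.mul_assoc _ _ (Iminus n ℂ), Iminus_mul_self, Matrix.mul_one]

theorem tauL_actL {n : ℕ} (g : Sp n ℚ) (L : Submodule ℂ (Fin n ⊕ Fin n → ℂ)) :
    tauL (actL g L) = actL (tau g) (tauL L) := by
  ext v
  simp only [mem_tauL, actL, Submodule.mem_map, Matrix.mulVecLin_apply]
  constructor
  · rintro ⟨w, hw, hwv⟩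
    refine ⟨tauVec w, ?_, ?_⟩
    · rwa [tauVec_tauVec]
    · rw [← tauVec_mulVec, hwv, tauVec_tauVec]
  · rintro ⟨w, hw, hwv⟩
    refine ⟨tauVec w, hw, ?_⟩
    have htt : tau (tau g) = g := by
      apply Subtype.ext
      rw [coe_tau, coe_tau, ← Matrix.mul_assoc, ← Matrix.mul_assoc, Iminus_mul_self, Matrix.one_mul,
        Matrix.mul_assoc, Iminus_mul_self, Matrix.mul_one]
    rw [← hwv, tauVec_mulVec, htt]

theorem tauL_lagr {n q : ℕ} (hq : q ≤ n) (Z : Matrix (Fin q) (Fin q) ℂ) :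
    tauL (lagr hq Z) = lagr hq (tauMat Z) := by
  ext v
  rw [mem_tauL]
  change (_ ∧ _) ↔ (_ ∧ _)
  refine and_congr ?_ ?_
  · simp [tauVec_inr]
  · refine forall_congr' fun i => ?_
    simp only [tauVec_inl, tauVec_inr, tauMat, Matrix.map_apply]
    rw [← star_inj, star_neg, star_star, star_sum, neg_eq_iff_eq_neg, ← Finset.sum_neg_distrib]
    simp

/-- The extension of `τ(Z) = -conj Z` to the Satake partial compactification. -/
def tauH {n : ℕ} (x : Hbar n) : Hbar n :=
  ⟨tauL x.1, by
    obtain ⟨g, q, hq, Z, hx⟩ := x.2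
    exact ⟨tau g, q, hq, ⟨tauMat Z, tauMat_mem Z.2⟩, by rw [hx, tauL_actL, tauL_lagr]⟩⟩

theorem tauH_smul {n : ℕ} (g : Sp n ℚ) (x : Hbar n) : tauH (g • x) = tau g • tauH x :=
  Subtype.ext (tauL_actL g x.1)

theorem tauH_smul_int {n : ℕ} (g : Sp n ℤ) (x : Hbar n) : tauH (g • x) = tau g • tauH x := by
  rw [int_smul_def, tauH_smul, tau_mapSp, ← int_smul_def]

/-- The set `F^γ = {x ∈ F | τ(x) = γ x}` of `γ`-real points of `F`. -/
def realPts {n : ℕ} (F : Set (Hbar n)) (γ : Sp n ℤ) : Set (Hbar n) :=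
  {x | x ∈ F ∧ tauH x = γ • x}

/-- `(F, γ)` is a `Γ(4m)`-real boundary pair of rank `q`. -/
structure IsRealBoundaryPair {n q : ℕ} (m : ℕ) (hq : q ≤ n) (F : Set (Hbar n)) (γ : Sp n ℤ) :
    Prop where
  rational : IsRationalBoundaryComponent hq F
  mem : γ ∈ Gam n (4 * m)
  nonempty : (realPts F γ).Nonempty

/-! ### The parabolic subgroup `P_q`, the projection `ν` and the elements `j_r` -/

/-- Membership in the maximal parabolic subgroup `P_q` (the normalizer of `F_q`) of a symplectic
matrix: with respect to the block sizes `q, n - q, q, n - q` it has the shape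
`(A, 0, B, *; *, *, *, *; C, 0, D, *; 0, 0, 0, *)`. -/
def IsParabolic {n : ℕ} (q : ℕ) {R : Type} [CommRing R] (g : Sp n R) : Prop :=
  let M : Matrix (Fin n ⊕ Fin n) (Fin n ⊕ Fin n) R := g
  ∀ i j : Fin n,
    ((i : ℕ) < q → q ≤ (j : ℕ) → M (Sum.inl i) (Sum.inl j) = 0) ∧
    ((i : ℕ) < q → q ≤ (j : ℕ) → M (Sum.inr i) (Sum.inl j) = 0) ∧
    (q ≤ (i : ℕ) → M (Sum.inr i) (Sum.inl j) = 0) ∧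
    (q ≤ (i : ℕ) → (j : ℕ) < q → M (Sum.inr i) (Sum.inr j) = 0)

/-- The projection `ν` of `P_q` to its Hermitian factor `Sp(2q)`, sending the matrix displayed in
`IsParabolic` to `(A, B; C, D)`. -/
def nu {n q : ℕ} (hq : q ≤ n) {R : Type} [CommRing R] (g : Sp n R) :
    Matrix (Fin q ⊕ Fin q) (Fin q ⊕ Fin q) R :=
  g.1.submatrix (Sum.map (Fin.castLE hq) (Fin.castLE hq))
    (Sum.map (Fin.castLE hq) (Fin.castLE hq))

/-- The set of integral elements of `ker ν ⊆ P_q`. -/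
def kerNu {n q : ℕ} (hq : q ≤ n) : Set (Sp n ℤ) :=
  {g | IsParabolic q g ∧ nu hq g = 1}

/-- The matrix `j_r`; with respect to the block sizes `r, s, r, s`, `s = n - r`, it is
`(1, 0, 0, 0; 0, 0, 0, 1; 0, 0, 1, 0; 0, -1, 0, 0)`. -/
def jmat (n r : ℕ) : Sp n ℤ :=
  ⟨Matrix.fromBlocks
    (Matrix.diagonal fun i : Fin n => if (i : ℕ) < r then 1 else 0)
    (Matrix.diagonal fun i : Fin n => if (i : ℕ) < r then 0 else 1)
    (Matrix.diagonal fun i : Fin n => if (i : ℕ) < r then 0 else -1)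
    (Matrix.diagonal fun i : Fin n => if (i : ℕ) < r then 1 else 0), by
    rw [SymplecticGroup.fromBlocks_mem_iff]
    simp only [Matrix.diagonal_transpose, Matrix.diagonal_mul_diagonal, Matrix.diagonal_sub,
      ← Matrix.diagonal_one]
    refine ⟨?_, ?_, ?_⟩ <;>
    · congr 1
      funext i
      split_ifs <;> simp⟩

/-! ### The Satake topology -/

/-- The basic neighbourhood of a point of the standard boundary component `F_q` given by a
neighbourhood `U` in `𝔥_q` and a constant `K`.  It is the saturation under the integral points of
`ker ν` of the set of all `φ(W)`, `W ∈ 𝔥_{q'}`, `q ≤ q' ≤ n`, such that, writing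
`W = (W₁, W₁₂; W₂₁, W₂)` with `W₁` of size `q` and `Y = Im W`, one has `W₁ ∈ U` and
`Y₂ - Y₂₁ Y₁⁻¹ Y₁₂ > K • I` (which, as `Y₁ > 0`, says that `Y - K • (0, 0; 0, I) > 0`). -/
def basicNhd {n q : ℕ} (hq : q ≤ n) (U : Set (Matrix (Fin q) (Fin q) ℂ)) (K : ℝ) :
    Set (Hbar n) :=
  {y | ∃ δ ∈ kerNu hq, ∃ (q' : ℕ) (h₁ : q ≤ q') (h₂ : q' ≤ n) (W : siegel q'),
    (W : Matrix (Fin q') (Fin q') ℂ).submatrix (Fin.castLE h₁) (Fin.castLE h₁) ∈ U ∧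
    ((W : Matrix (Fin q') (Fin q') ℂ).map Complex.im -
      K • Matrix.diagonal fun i : Fin q' => if (i : ℕ) < q then (0 : ℝ) else 1).PosDef ∧
    y = δ • phi h₂ W}

theorem basicNhd_mono {n q : ℕ} (hq : q ≤ n) {U U' : Set (Matrix (Fin q) (Fin q) ℂ)} {K K' : ℝ}
    (hU : U ⊆ U') (hK : K' ≤ K) : basicNhd hq U K ⊆ basicNhd (n := n) hq U' K' := by
  rintro y ⟨δ, hδ, q', h₁, h₂, W, hW, hpos, hy⟩
  refine ⟨δ, hδ, q', h₁, h₂, W, hU hW, ?_, hy⟩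
  have hsemi : ((K - K') • Matrix.diagonal fun i : Fin q' =>
      if (i : ℕ) < q then (0 : ℝ) else 1).PosSemidef := by
    rw [← Matrix.diagonal_smul]
    refine Matrix.PosSemidef.diagonal fun i => ?_
    simp only [Pi.smul_apply, smul_eq_mul, Pi.zero_apply]
    split_ifs <;> simp [hK]
  have := hpos.add_posSemidef hsemi
  rw [sub_smul] at this
  convert this using 1
  abel

/-- The Satake topology: a set is open iff with every point `g φ(Z)`, `g ∈ Sp(2n, ℚ)`, `Z ∈ 𝔥_q`,
it contains the translate by `g` of a basic neighbourhood of `φ(Z)`. -/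
noncomputable instance instSatakeTopology (n : ℕ) : TopologicalSpace (Hbar n) where
  IsOpen O := ∀ (g : Sp n ℚ) (q : ℕ) (hq : q ≤ n) (Z : siegel q), g • phi hq Z ∈ O →
    ∃ U ∈ 𝓝 (Z : Matrix (Fin q) (Fin q) ℂ), ∃ K : ℝ, ∀ y ∈ basicNhd hq U K, g • y ∈ O
  isOpen_univ := fun _ _ _ _ _ => ⟨Set.univ, Filter.univ_mem, 0, fun _ _ => trivial⟩
  isOpen_inter := by
    intro s t hs ht g q hq Z hZ
    obtain ⟨U, hU, K, h⟩ := hs g q hq Z hZ.1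
    obtain ⟨U', hU', K', h'⟩ := ht g q hq Z hZ.2
    exact ⟨U ∩ U', Filter.inter_mem hU hU', max K K', fun y hy =>
      ⟨h y (basicNhd_mono hq Set.inter_subset_left (le_max_left _ _) hy),
        h' y (basicNhd_mono hq Set.inter_subset_right (le_max_right _ _) hy)⟩⟩
  isOpen_sUnion := by
    intro S hS g q hq Z hZ
    obtain ⟨s, hs, hZs⟩ := hZ
    obtain ⟨U, hU, K, h⟩ := hS s hs g q hq Z hZs
    exact ⟨U, hU, K, fun y hy => ⟨s, hs, h y hy⟩⟩

/-! ### The Baily-Borel compactification -/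

/-- The Baily-Borel compactification `V = Γ(N) \ Hbar n`, with the quotient topology. -/
abbrev BailyBorel (n N : ℕ) : Type := Quotient (MulAction.orbitRel (Gam n N) (Hbar n))

/-- The projection `π : Hbar n → V`. -/
noncomputable def proj {n : ℕ} (N : ℕ) (x : Hbar n) : BailyBorel n N := Quotient.mk _ x

/-- The involution of `V` induced by `τ`, that is, complex conjugation on `V`. -/
noncomputable def tauV {n N : ℕ} : BailyBorel n N → BailyBorel n N :=
  Quotient.map tauH (by
    rintro x y ⟨γ, rfl⟩
    exact ⟨⟨tau γ.1, tau_mem_Gam γ.2⟩, (tauH_smul_int γ.1 y).symm⟩)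

/-- The real points `V_ℝ` of the Baily-Borel compactification. -/
def VR (n N : ℕ) : Set (BailyBorel n N) := {v | tauV v = v}

/-- The real points `X_ℝ` of `X = Γ(N) \ 𝔥_n ⊆ V`. -/
def XR (n N : ℕ) : Set (BailyBorel n N) := Set.range (fun Z : siegel n => proj N (incl Z)) ∩ VR n N

/-- The closure of `X_ℝ` in `V_ℝ`, as a subset of `V`. -/
def XRclosure (n N : ℕ) : Set (BailyBorel n N) := closure (XR n N) ∩ VR n N

end Satake

open Satake

namespace Satake

open scoped ComplexOrder

/-! ### The action of `Sp(2n, ℤ)` on points of the partial compactification -/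

/-! Write `j` for `jmat n r` and `u = τ(g)⁻¹ γ g`. Since `τ(j) = j⁻¹`, the element `ω` equals `τ(g)
j⁻² g⁻¹`, so `j⁻²` plays for `ω` the role that `u` plays for `γ`. Moreover `ω γ⁻¹` is the conjugate
of `(j u j)⁻¹` by `τ(g) j⁻¹`, and `Γ(4m)` is normal, so `ω` lies in `Γ(4m)`.

Both `u` and, because `q ≤ r`, `j⁻²` act trivially on `F_q`. At a point `x = g φ(Z)` of `F` this
gives `γ x = ω x = τ(g) φ(Z)`, while `τ(x) = τ(g) φ(τ Z)`. Hence either reality condition says `τ Z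
= Z`, and the two real loci of `F` agree (`realPts_image_stdF`, `kerNu_smul_phi`).

For such a `Z` put `W_t = diag(Z, i t I)` with `t > 0`. It is fixed by `τ`, and by `j²` as well,
since `j²` only changes signs inside the scalar block (`jmat_mul_self_smul_incl`). So `τ(g W_t) =
τ(g) W_t = ω g W_t`, that is, `g W_t` is `ω`-real, and `g φ(Z)` is adherent to these points in the
Satake topology (`smul_mem_closure`). Continuity of `π` gives the final claim.

Points of the compactification are Lagrangian subspaces, whereas `realLocus` uses fractional linear
transformations; `smul_incl` reconciles the two actions. -/

theorem intSmul_val {n : ℕ} (g : Sp n ℤ) (x : Hbar n) :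
    (g • x).1 = x.1.map ((g.1.map (Int.cast : ℤ → ℂ)).mulVecLin) := by
  change Submodule.map (((g.1.map _).map _).mulVecLin) x.1 = _
  rw [Matrix.map_map]
  rfl

/-- Stability is enough: `g` is invertible, so the image has the same dimension as the subspace
containing it. -/
theorem smul_phi_eq_self {n q : ℕ} (hq : q ≤ n) (g : Sp n ℤ) (Z : siegel q)
    (h : ∀ v ∈ lagr hq Z.1, (g.1.map (Int.cast : ℤ → ℂ)) *ᵥ v ∈ lagr hq Z.1) :
    g • phi hq Z = phi hq Z := by
  apply Subtype.ext
  rw [intSmul_val]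
  have hinj : Function.Injective ((g.1.map (Int.cast : ℤ → ℂ)).mulVecLin) := by
    refine Matrix.mulVec_injective_iff_isUnit.2 ?_
    have h1 : g⁻¹.1 * g.1 = 1 := congrArg Subtype.val (inv_mul_cancel g)
    have h2 : (g⁻¹.1 * g.1).map (Int.castRingHom ℂ) = 1 := by rw [h1]; simp
    rw [Matrix.map_mul] at h2
    exact (Matrix.isUnit_iff_isUnit_det _).2 (Matrix.isUnit_det_of_left_inverse h2)
  refine Submodule.eq_of_le_of_finrank_eq
    (Submodule.map_le_iff_le_comap.2 fun v hv => h v hv) ?_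
  exact (LinearEquiv.finrank_eq (Submodule.equivMapOfInjective _ hinj _)).symm

theorem phi_injective {n q : ℕ} (hq : q ≤ n) : Function.Injective (phi (n := n) hq) := by
  intro Z W h
  have hL : lagr hq Z.1 = lagr (n := n) hq W.1 := congrArg Subtype.val h
  apply Subtype.ext
  ext i k
  -- The vector with lower half `e_k` and upper half the `k`-th column of `Z`, padded by zeros.
  -- Membership in the subspace of `W` forces the `k`-th columns of `Z` and `W` to agree.
  let v : Fin n ⊕ Fin n → ℂ := Sum.elim
    (fun a => if ha : (a : ℕ) < q then Z.1 ⟨a, ha⟩ k else 0) (Pi.single (Fin.castLE hq k) 1)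
  have hsum : ∀ M : Matrix (Fin q) (Fin q) ℂ, ∀ i,
      ∑ l, M i l * v (Sum.inr (Fin.castLE hq l)) = M i k := by
    intro M i
    rw [Finset.sum_eq_single k]
    · simp [v]
    · intro l _ hl
      simp [v, hl]
    · simp
  have hv : v ∈ lagr hq Z.1 := by
    refine ⟨fun a ha => ?_, fun i => ?_⟩
    · have : a ≠ Fin.castLE hq k := fun h => by
        have := congrArg Fin.val h
        simp only [Fin.val_castLE] at this
        omega
      simp [v, this]
    · rw [hsum]
      simp [v]
  rw [hL] at hv
  have := hv.2 i
  rw [hsum] at this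
  simpa [v] using this

theorem tauH_phi {n q : ℕ} (hq : q ≤ n) (Z : siegel q) :
    tauH (phi hq Z) = phi (n := n) hq ⟨tauMat Z.1, tauMat_mem Z.2⟩ :=
  Subtype.ext (tauL_lagr hq Z.1)

theorem mem_lagr {n q : ℕ} {hq : q ≤ n} {Z : Matrix (Fin q) (Fin q) ℂ}
    {v : Fin n ⊕ Fin n → ℂ} : v ∈ lagr hq Z ↔
      (∀ i : Fin n, q ≤ (i : ℕ) → v (Sum.inr i) = 0) ∧
      ∀ i : Fin q, v (Sum.inl (Fin.castLE hq i)) =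
        ∑ k, Z i k * v (Sum.inr (Fin.castLE hq k)) := Iff.rfl

theorem mem_lagr_self {n : ℕ} {Z : Matrix (Fin n) (Fin n) ℂ} {v : Fin n ⊕ Fin n → ℂ} :
    v ∈ lagr le_rfl Z ↔ v ∘ Sum.inl = Z *ᵥ (v ∘ Sum.inr) := by
  rw [mem_lagr, funext_iff]
  refine ⟨fun h i => h.2 i, fun h => ⟨fun i hi => absurd i.2 (not_lt.2 hi), fun i => h i⟩⟩

/-- `ker ν` acts trivially on the standard boundary component. -/
theorem kerNu_smul_phi {n q : ℕ} (hq : q ≤ n) {u : Sp n ℤ} (hu : u ∈ kerNu hq) (Z : siegel q) :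
    u • phi hq Z = phi hq Z := by
  obtain ⟨hP, hν⟩ := hu
  have hν' : ∀ a b, u.1 (Sum.map (Fin.castLE hq) (Fin.castLE hq) a)
      (Sum.map (Fin.castLE hq) (Fin.castLE hq) b) = if a = b then 1 else 0 := by
    intro a b
    have := congrFun (congrFun hν a) b
    rwa [Matrix.one_apply] at this
  have hlt : ∀ i : Fin n, (i : ℕ) < q → ∃ k, i = Fin.castLE hq k := fun i hi => ⟨⟨i, hi⟩, rfl⟩
  apply smul_phi_eq_self
  rintro v ⟨hv0, hv1⟩
  -- On the subspace, `u` leaves every coordinate of index below `q` unchanged: the upper columns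
  -- from `q` on vanish in these rows by the parabolic shape, the lower coordinates of `v` from `q`
  -- on are zero, and the remaining block is `ν(u) = 1`.
  have key : ∀ a, ((u.1.map (Int.cast : ℤ → ℂ)) *ᵥ v)
      (Sum.map (Fin.castLE hq) (Fin.castLE hq) a) =
      v (Sum.map (Fin.castLE hq) (Fin.castLE hq) a) := by
    intro a
    simp only [Matrix.mulVec, dotProduct, Matrix.map_apply]
    rw [Finset.sum_eq_single (Sum.map (Fin.castLE hq) (Fin.castLE hq) a)]
    · simp [hν']
    · rintro (i | i) _ hi
      · by_cases h : (i : ℕ) < q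
        · obtain ⟨k, rfl⟩ := hlt i h
          have h1 := hν' a (Sum.inl k)
          rw [if_neg (by rintro rfl; exact hi rfl)] at h1
          rw [Sum.map_inl] at h1
          simp [h1]
        · rcases a with a | a
          · have := (hP (Fin.castLE hq a) i).1 a.2 (not_lt.1 h)
            simp [this]
          · have := (hP (Fin.castLE hq a) i).2.1 a.2 (not_lt.1 h)
            simp [this]
      · by_cases h : (i : ℕ) < q
        · obtain ⟨k, rfl⟩ := hlt i h
          have h1 := hν' a (Sum.inr k)
          rw [if_neg (by rintro rfl; exact hi rfl)] at h1
          rw [Sum.map_inr] at h1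
          simp [h1]
        · simp [hv0 i (not_lt.1 h)]
    · simp
  refine ⟨fun i hi => ?_, fun i => ?_⟩
  · simp only [Matrix.mulVec, dotProduct, Matrix.map_apply]
    refine Finset.sum_eq_zero ?_
    rintro (k | k) _
    · simp [(hP i k).2.2.1 hi]
    · by_cases h : (k : ℕ) < q
      · simp [(hP i k).2.2.2 hi h]
      · simp [hv0 k (not_lt.1 h)]
  · have h1 := key (Sum.inl i)
    have h2 := fun k => key (Sum.inr k)
    simp only [Sum.map_inl, Sum.map_inr] at h1 h2
    rw [h1, hv1 i]
    simp only [h2]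

/-! ### Fractional linear transformations -/

/-- For real symmetric `S` the Hermitian form at `x + iy` is `S[x] + S[y]`, the cross terms
cancelling by symmetry. This lets the real condition `Im Z > 0` be transported by complex
congruences. -/
theorem posDef_map_ofReal_iff {n : ℕ} {S : Matrix (Fin n) (Fin n) ℝ} :
    (S.map ((↑) : ℝ → ℂ)).PosDef ↔ S.PosDef := by
  have hform : ∀ x : Fin n → ℝ, star (fun i => (x i : ℂ)) ⬝ᵥ
      (S.map ((↑) : ℝ → ℂ)) *ᵥ (fun i => (x i : ℂ)) = ((star x ⬝ᵥ S *ᵥ x : ℝ) : ℂ) := by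
    intro x
    simp [dotProduct, Matrix.mulVec]
  constructor
  · intro h
    refine Matrix.PosDef.of_dotProduct_mulVec_pos ?_ fun x hx => ?_
    · ext i j
      have := h.1.apply i j
      simpa using this
    · have := h.dotProduct_mulVec_pos (x := fun i => (x i : ℂ)) (fun h0 => hx (by
        ext i
        simpa using congrFun h0 i))
      rw [hform] at this
      exact_mod_cast this
  · intro h
    refine Matrix.PosDef.of_dotProduct_mulVec_pos ?_ fun x hx => ?_
    · ext i j
      have := h.1.apply i j
      simpa using this
    · have hre : star x ⬝ᵥ (S.map ((↑) : ℝ → ℂ)) *ᵥ x =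
          ((star (fun i => (x i).re) ⬝ᵥ S *ᵥ (fun i => (x i).re) +
            star (fun i => (x i).im) ⬝ᵥ S *ᵥ (fun i => (x i).im) : ℝ) : ℂ) := by
        apply Complex.ext
        · simp [dotProduct, Matrix.mulVec, Finset.sum_add_distrib]
        · simp only [dotProduct, Matrix.mulVec, Pi.star_apply, Matrix.map_apply, Complex.im_sum,
            Complex.mul_im, Complex.ofReal_im, Complex.ofReal_re, Complex.mul_re, Finset.mul_sum, Complex.star_def, Complex.conj_re,
            Complex.conj_im, Finset.sum_add_distrib]
          simp only [zero_mul, add_zero, sub_zero]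
          rw [Finset.sum_comm (f := fun i j => -(x i).im * (S i j * (x j).re)),
            ← Finset.sum_add_distrib]
          refine Finset.sum_eq_zero fun i _ => ?_
          rw [← Finset.sum_add_distrib]
          refine Finset.sum_eq_zero fun j _ => ?_
          have : S j i = S i j := by simpa using h.1.apply i j
          rw [this]
          ring
      rw [hre]
      have hnn : ∀ y : Fin n → ℝ, 0 ≤ star y ⬝ᵥ S *ᵥ y :=
        fun y => h.posSemidef.dotProduct_mulVec_nonneg y
      norm_cast
      by_cases h0 : (fun i => (x i).re) = 0
      · have h1 : (fun i => (x i).im) ≠ 0 := fun h1 => hx (by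
          ext i
          exact Complex.ext (congrFun h0 i) (congrFun h1 i))
        exact add_pos_of_nonneg_of_pos (hnn _) (h.dotProduct_mulVec_pos h1)
      · exact add_pos_of_pos_of_nonneg (h.dotProduct_mulVec_pos h0) (hnn _)

theorem sub_conjTranspose_of_symm {n : ℕ} {Z : Matrix (Fin n) (Fin n) ℂ} (hZ : Zᵀ = Z) :
    Z - Zᴴ = (2 * Complex.I) • (Z.map Complex.im).map ((↑) : ℝ → ℂ) := by
  ext i j
  have : Z j i = Z i j := congrFun (congrFun hZ i) j
  simp only [Matrix.sub_apply, Matrix.conjTranspose_apply, this, Matrix.smul_apply,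
    Matrix.map_apply, smul_eq_mul]
  apply Complex.ext <;> simp
  ring

/-- The blocks `A Z + B` and `C Z + D`. -/
noncomputable def numer {n : ℕ} (γ : Sp n ℤ) (Z : Matrix (Fin n) (Fin n) ℂ) :
    Matrix (Fin n) (Fin n) ℂ :=
  (γ.1.map (Int.cast : ℤ → ℂ)).toBlocks₁₁ * Z + (γ.1.map (Int.cast : ℤ → ℂ)).toBlocks₁₂

/-- The automorphy factor `C Z + D`. -/
noncomputable def denom {n : ℕ} (γ : Sp n ℤ) (Z : Matrix (Fin n) (Fin n) ℂ) :
    Matrix (Fin n) (Fin n) ℂ :=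
  (γ.1.map (Int.cast : ℤ → ℂ)).toBlocks₂₁ * Z + (γ.1.map (Int.cast : ℤ → ℂ)).toBlocks₂₂

theorem blocks_mem {n : ℕ} (γ : Sp n ℤ) :
    Matrix.fromBlocks (γ.1.map (Int.cast : ℤ → ℂ)).toBlocks₁₁
      (γ.1.map (Int.cast : ℤ → ℂ)).toBlocks₁₂ (γ.1.map (Int.cast : ℤ → ℂ)).toBlocks₂₁
      (γ.1.map (Int.cast : ℤ → ℂ)).toBlocks₂₂ ∈ Matrix.symplecticGroup (Fin n) ℂ := by
  rw [Matrix.fromBlocks_toBlocks]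
  exact coe_mapSp_mem (Int.castRingHom ℂ) γ

/-- Invariance of the symplectic form under `γ`, evaluated on the columns of `(X; 1)` and `(Z; 1)`.
Keeping `X` free serves twice: `X = Z` gives symmetry of `γ Z`, and `X = conj Z` gives positivity of
its imaginary part. -/
theorem denom_transpose_mul_numer {n : ℕ} (γ : Sp n ℤ) (X Z : Matrix (Fin n) (Fin n) ℂ) :
    (denom γ X)ᵀ * numer γ Z - (numer γ X)ᵀ * denom γ Z = Z - Xᵀ := by
  obtain ⟨h1, h2, h3⟩ := SymplecticGroup.fromBlocks_mem_iff.1 (blocks_mem γ)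
  unfold denom numer
  set A := (γ.1.map (Int.cast : ℤ → ℂ)).toBlocks₁₁
  set B := (γ.1.map (Int.cast : ℤ → ℂ)).toBlocks₁₂
  set C := (γ.1.map (Int.cast : ℤ → ℂ)).toBlocks₂₁
  set D := (γ.1.map (Int.cast : ℤ → ℂ)).toBlocks₂₂
  have h4 : Dᵀ * A - Bᵀ * C = 1 := by
    simpa [Matrix.transpose_sub, Matrix.transpose_mul] using congrArg Matrix.transpose h3
  calc (C * X + D)ᵀ * (A * Z + B) - (A * X + B)ᵀ * (C * Z + D)
      = (Dᵀ * A - Bᵀ * C) * Z - Xᵀ * (Aᵀ * D - Cᵀ * B)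
        - Xᵀ * (Aᵀ * C - Cᵀ * A) * Z - (Bᵀ * D - Dᵀ * B) := by
        rw [Matrix.transpose_add, Matrix.transpose_add, Matrix.transpose_mul,
          Matrix.transpose_mul]
        noncomm_ring
    _ = Z - Xᵀ := by
        rw [h1, h2, h3, h4]
        simp

theorem denom_conjTranspose {n : ℕ} (γ : Sp n ℤ) (Z : Matrix (Fin n) (Fin n) ℂ) :
    (denom γ Z)ᴴ = (denom γ (Z.map star))ᵀ := by
  ext i j
  simp [denom, Matrix.mul_apply, Matrix.toBlocks₂₁, Matrix.toBlocks₂₂]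

theorem numer_conjTranspose {n : ℕ} (γ : Sp n ℤ) (Z : Matrix (Fin n) (Fin n) ℂ) :
    (numer γ Z)ᴴ = (numer γ (Z.map star))ᵀ := by
  ext i j
  simp [numer, Matrix.mul_apply, Matrix.toBlocks₁₁, Matrix.toBlocks₁₂]

theorem denom_conjTranspose_mul_numer {n : ℕ} (γ : Sp n ℤ) {Z : Matrix (Fin n) (Fin n) ℂ}
    (hZ : Zᵀ = Z) : (denom γ Z)ᴴ * numer γ Z - (numer γ Z)ᴴ * denom γ Z =
      (2 * Complex.I) • (Z.map Complex.im).map ((↑) : ℝ → ℂ) := by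
  rw [denom_conjTranspose, numer_conjTranspose, denom_transpose_mul_numer,
    ← sub_conjTranspose_of_symm hZ]
  rfl

/-- If `v` is killed by `C Z + D`, evaluating the preceding identity at `v` yields `v* (Im Z) v =
0`, hence `v = 0`. -/
theorem isUnit_det_denom {n : ℕ} (γ : Sp n ℤ) {Z : Matrix (Fin n) (Fin n) ℂ}
    (hZ : Z ∈ siegel n) : IsUnit (denom γ Z).det := by
  rw [← Matrix.isUnit_iff_isUnit_det, ← Matrix.mulVec_injective_iff_isUnit]
  refine (injective_iff_map_eq_zero (denom γ Z).mulVecLin).2 fun v hv => ?_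
  rw [Matrix.mulVecLin_apply] at hv
  by_contra hv0
  have hpos := (posDef_map_ofReal_iff.2 hZ.2).dotProduct_mulVec_pos hv0
  have h := congrArg (fun M => star v ⬝ᵥ M *ᵥ v) (denom_conjTranspose_mul_numer γ hZ.1)
  simp only [Matrix.sub_mulVec, ← Matrix.mulVec_mulVec, hv, Matrix.mulVec_zero, sub_zero,
    Matrix.smul_mulVec, dotProduct_smul] at h
  rw [Matrix.dotProduct_mulVec, ← Matrix.star_mulVec, hv, star_zero, zero_dotProduct,
    eq_comm, smul_eq_mul, mul_eq_zero] at h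
  rcases h with h | h
  · simp at h
  · exact hpos.ne' h

theorem moebius_eq {n : ℕ} (γ : Sp n ℤ) (Z : Matrix (Fin n) (Fin n) ℂ) :
    moebius γ Z = numer γ Z * (denom γ Z)⁻¹ := rfl

theorem moebius_mem {n : ℕ} (γ : Sp n ℤ) {Z : Matrix (Fin n) (Fin n) ℂ}
    (hZ : Z ∈ siegel n) : moebius γ Z ∈ siegel n := by
  have hdet := isUnit_det_denom γ hZ
  have hW : moebius γ Z * denom γ Z = numer γ Z := by
    rw [moebius_eq, Matrix.mul_assoc, Matrix.nonsing_inv_mul _ hdet, Matrix.mul_one]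
  have hR : IsUnit (denom γ Z) := (Matrix.isUnit_iff_isUnit_det _).2 hdet
  have hsymm : (moebius γ Z)ᵀ = moebius γ Z := by
    have h := denom_transpose_mul_numer γ Z Z
    rw [hZ.1, sub_self, ← hW, Matrix.transpose_mul, ← Matrix.mul_assoc, ← Matrix.sub_mul,
      hR.mul_left_eq_zero, ← Matrix.mul_sub] at h
    have hR' : IsUnit (denom γ Z)ᵀ := by
      rw [Matrix.isUnit_iff_isUnit_det, Matrix.det_transpose]
      exact hdet
    rw [hR'.mul_right_eq_zero] at h
    exact (sub_eq_zero.1 h).symm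
  refine ⟨hsymm, posDef_map_ofReal_iff.1 ?_⟩
  -- With `R = C Z + D` this becomes `Rᴴ Im(γ Z) R = Im Z`, a congruence by an invertible matrix,
  -- which preserves definiteness.
  have h := denom_conjTranspose_mul_numer γ hZ.1
  rw [← hW, Matrix.conjTranspose_mul, ← Matrix.mul_assoc, ← Matrix.sub_mul, ← Matrix.mul_sub,
    sub_conjTranspose_of_symm hsymm, Matrix.mul_smul, Matrix.smul_mul] at h
  have h2 := smul_right_injective _ (by simp : (2 * Complex.I) ≠ 0) h
  rw [← Matrix.IsUnit.posDef_star_left_conjugate_iff hR, Matrix.star_eq_conjTranspose, h2]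
  exact posDef_map_ofReal_iff.2 hZ.2

/-- `γ` sends `(Z b, b)` to `((A Z + B) b, (C Z + D) b)`, and the substitution `b ↦ (C Z + D)⁻¹ b`
exhibits the image as the graph of `γ Z`. -/
theorem smul_incl {n : ℕ} (γ : Sp n ℤ) (Z : siegel n) :
    γ • incl Z = incl ⟨moebius γ Z.1, moebius_mem γ Z.2⟩ := by
  have hdet := isUnit_det_denom γ Z.2
  have hmul : ∀ b : Fin n → ℂ, (γ.1.map (Int.cast : ℤ → ℂ)) *ᵥ Sum.elim (Z.1 *ᵥ b) b =
      Sum.elim (numer γ Z.1 *ᵥ b) (denom γ Z.1 *ᵥ b) := by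
    intro b
    conv_lhs => rw [← Matrix.fromBlocks_toBlocks (γ.1.map (Int.cast : ℤ → ℂ))]
    rw [Matrix.fromBlocks_mulVec]
    simp [numer, denom, Matrix.add_mulVec, Matrix.mulVec_mulVec]
  apply Subtype.ext
  rw [intSmul_val]
  refine le_antisymm (Submodule.map_le_iff_le_comap.2 fun v hv => ?_) fun v hv => ?_
  · have hv' := mem_lagr_self.1 hv
    rw [Submodule.mem_comap, Matrix.mulVecLin_apply]
    refine mem_lagr_self.2 ?_
    have : v = Sum.elim (Z.1 *ᵥ (v ∘ Sum.inr)) (v ∘ Sum.inr) := by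
      rw [← hv', Sum.elim_comp_inl_inr]
    rw [this, hmul, Sum.elim_comp_inl, Sum.elim_comp_inr, Matrix.mulVec_mulVec]
    simp only [moebius_eq, Matrix.mul_assoc, Matrix.nonsing_inv_mul _ hdet, Matrix.mul_one]
  · have hv' := mem_lagr_self.1 hv
    refine ⟨Sum.elim (Z.1 *ᵥ ((denom γ Z.1)⁻¹ *ᵥ (v ∘ Sum.inr)))
      ((denom γ Z.1)⁻¹ *ᵥ (v ∘ Sum.inr)), mem_lagr_self.2 (by simp), ?_⟩
    rw [Matrix.mulVecLin_apply, hmul, Matrix.mulVec_mulVec, Matrix.mulVec_mulVec,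
      Matrix.mul_nonsing_inv _ hdet, Matrix.one_mulVec, ← moebius_eq, ← hv',
      Sum.elim_comp_inl_inr]

theorem mem_realLocus_iff {n : ℕ} (γ : Sp n ℤ) (Z : siegel n) :
    Z ∈ realLocus γ ↔ tauH (incl Z) = γ • incl Z := by
  rw [smul_incl]
  refine ⟨fun h => (tauH_phi le_rfl Z).trans (congrArg incl (Subtype.ext (Eq.symm h))),
    fun h => ?_⟩
  have := phi_injective le_rfl ((tauH_phi le_rfl Z).symm.trans h)
  exact (congrArg Subtype.val this).symm

/-! ### The element `j_r` and block diagonal points -/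

theorem tau_jmat (n r : ℕ) : tau (jmat n r) = (jmat n r)⁻¹ := by
  apply eq_inv_of_mul_eq_one_left
  apply Subtype.ext
  have h : (tau (jmat n r)).1 = Matrix.fromBlocks
      (Matrix.diagonal fun i : Fin n => if (i : ℕ) < r then 1 else 0)
      (Matrix.diagonal fun i : Fin n => if (i : ℕ) < r then 0 else -1)
      (Matrix.diagonal fun i : Fin n => if (i : ℕ) < r then 0 else 1)
      (Matrix.diagonal fun i : Fin n => if (i : ℕ) < r then 1 else 0) := by
    rw [coe_tau]
    simp only [Iminus, jmat, Matrix.fromBlocks_multiply, neg_mul, one_mul, mul_neg, mul_one,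
      zero_mul, mul_zero, add_zero, zero_add, neg_neg, Matrix.diagonal_neg]
    congr 2 <;> funext i <;> split_ifs <;> simp
  rw [Submonoid.coe_mul, h, Submonoid.coe_one, ← Matrix.fromBlocks_one]
  simp only [jmat, Matrix.fromBlocks_multiply, ← Matrix.diagonal_one, ← Matrix.diagonal_zero,
    Matrix.diagonal_mul_diagonal, Matrix.diagonal_add]
  congr 2 <;> funext i <;> split_ifs <;> simp

theorem jmat_mul_self (n r : ℕ) : (jmat n r * jmat n r).1 = Matrix.fromBlocks
    (Matrix.diagonal fun i : Fin n => if (i : ℕ) < r then 1 else -1) 0 0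
    (Matrix.diagonal fun i : Fin n => if (i : ℕ) < r then 1 else -1) := by
  rw [Submonoid.coe_mul]
  simp only [jmat, Matrix.fromBlocks_multiply, ← Matrix.diagonal_zero,
    Matrix.diagonal_mul_diagonal, Matrix.diagonal_add]
  congr 2 <;> funext i <;> split_ifs <;> simp

/-- `j_r²` is diagonal with sign `+1` on the first `r` indices of each half, hence on the first `q`,
as `q ≤ r`. -/
theorem jmat_mul_self_mem_kerNu {n q r : ℕ} (hqr : q ≤ r) (hq : q ≤ n) :
    jmat n r * jmat n r ∈ kerNu hq := by
  refine ⟨fun i j => ?_, ?_⟩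
  · have hne : ∀ {i j : Fin n}, (i : ℕ) ≠ j → i ≠ j := fun h h' => h (congrArg Fin.val h')
    simp only [jmat_mul_self, Matrix.fromBlocks_apply₁₁, Matrix.fromBlocks_apply₂₁,
      Matrix.fromBlocks_apply₂₂, Matrix.zero_apply, implies_true, true_and]
    exact ⟨fun h h' => Matrix.diagonal_apply_ne _ (hne (by omega)),
      fun h h' => Matrix.diagonal_apply_ne _ (hne (by omega))⟩
  · have hlt : ∀ a : Fin q, (a : ℕ) < r := fun a => a.2.trans_le hqr
    rw [nu, jmat_mul_self]
    ext (a | a) (b | b) <;> simp [Matrix.diagonal_apply, Matrix.one_apply, hlt]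

/-- The identification of the index set `n` with the sum of `q` and `n - q`. -/
def finSplit {n q : ℕ} (hq : q ≤ n) : Fin q ⊕ Fin (n - q) ≃ Fin n :=
  finSumFinEquiv.trans (finCongr (Nat.add_sub_cancel' hq))

theorem finSplit_inl {n q : ℕ} (hq : q ≤ n) (a : Fin q) :
    finSplit hq (Sum.inl a) = Fin.castLE hq a := rfl

theorem val_finSplit_inr {n q : ℕ} (hq : q ≤ n) (a : Fin (n - q)) :
    (finSplit hq (Sum.inr a) : ℕ) = q + a := rfl

/-- The block diagonal `n × n` matrix with blocks a given `q × q` matrix and a scalar. -/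
def blockExt {n q : ℕ} {R : Type} [CommRing R] (hq : q ≤ n) (Z : Matrix (Fin q) (Fin q) R)
    (c : R) : Matrix (Fin n) (Fin n) R :=
  Matrix.reindex (finSplit hq) (finSplit hq)
    (Matrix.fromBlocks Z 0 0 (Matrix.diagonal fun _ => c))

theorem blockExt_finSplit {n q : ℕ} {R : Type} [CommRing R] (hq : q ≤ n)
    (Z : Matrix (Fin q) (Fin q) R) (c : R) (a b : Fin q ⊕ Fin (n - q)) :
    blockExt hq Z c (finSplit hq a) (finSplit hq b) =
      Matrix.fromBlocks Z 0 0 (Matrix.diagonal fun _ => c) a b := by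
  simp [blockExt]

theorem ext_finSplit {n q : ℕ} {R : Type} (hq : q ≤ n) {M N : Matrix (Fin n) (Fin n) R}
    (h : ∀ a b, M (finSplit hq a) (finSplit hq b) = N (finSplit hq a) (finSplit hq b)) :
    M = N := by
  ext i j
  simpa using h ((finSplit hq).symm i) ((finSplit hq).symm j)

theorem blockExt_posDef {n q : ℕ} (hq : q ≤ n) {Y : Matrix (Fin q) (Fin q) ℝ} (hY : Y.PosDef)
    {c : ℝ} (hc : 0 < c) : (blockExt hq Y c).PosDef := by
  suffices h : (Matrix.fromBlocks Y 0 0 (Matrix.diagonal fun _ : Fin (n - q) => c)).PosDef from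
    h.submatrix (finSplit hq).symm.injective
  refine Matrix.PosDef.of_dotProduct_mulVec_pos ?_ fun x hx => ?_
  · exact Matrix.IsHermitian.fromBlocks hY.1 (by simp) (Matrix.isHermitian_diagonal _)
  · have h1 : star x ⬝ᵥ Matrix.fromBlocks Y 0 0 (Matrix.diagonal fun _ => c) *ᵥ x =
        star (x ∘ Sum.inl) ⬝ᵥ Y *ᵥ (x ∘ Sum.inl) + c * ∑ i, x (Sum.inr i) * x (Sum.inr i) := by
      rw [Matrix.fromBlocks_mulVec]
      simp only [dotProduct, Fintype.sum_sum_type, Sum.elim_inl, Sum.elim_inr]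
      congr 1
      · simp
      · rw [Finset.mul_sum]
        refine Finset.sum_congr rfl fun i _ => ?_
        simp
        ring
    rw [h1]
    have h2 : 0 ≤ ∑ i, x (Sum.inr i) * x (Sum.inr i) :=
      Finset.sum_nonneg fun i _ => mul_self_nonneg _
    by_cases h0 : x ∘ Sum.inl = 0
    · have h3 : ∃ i, x (Sum.inr i) ≠ 0 := by
        by_contra! h3
        refine hx ?_
        funext a
        rcases a with a | a
        · exact congrFun h0 a
        · exact h3 a
      obtain ⟨i, hi⟩ := h3
      refine add_pos_of_nonneg_of_pos (hY.posSemidef.dotProduct_mulVec_nonneg _)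
        (mul_pos hc (Finset.sum_pos' (fun i _ => mul_self_nonneg _) ⟨i, Finset.mem_univ _, ?_⟩))
      exact mul_self_pos.2 hi
    · exact add_pos_of_pos_of_nonneg (hY.dotProduct_mulVec_pos h0) (mul_nonneg hc.le h2)

theorem blockExt_map_im {n q : ℕ} (hq : q ≤ n) (Z : Matrix (Fin q) (Fin q) ℂ) (c : ℂ) :
    (blockExt hq Z c).map Complex.im = blockExt hq (Z.map Complex.im) c.im := by
  refine ext_finSplit hq fun a b => ?_
  rw [Matrix.map_apply, blockExt_finSplit, blockExt_finSplit]
  rcases a with a | a <;> rcases b with b | b <;> simp [Matrix.diagonal_apply]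
  split_ifs <;> simp

/-- Turns the positivity condition in `basicNhd` into the scalar inequality `c > K`. -/
theorem blockExt_sub_diagonal {n q : ℕ} (hq : q ≤ n) (Y : Matrix (Fin q) (Fin q) ℝ) (c K : ℝ) :
    blockExt hq Y c - K • Matrix.diagonal (fun i : Fin n => if (i : ℕ) < q then (0 : ℝ) else 1) =
      blockExt hq Y (c - K) := by
  refine ext_finSplit hq fun a b => ?_
  rw [Matrix.sub_apply, blockExt_finSplit, blockExt_finSplit, Matrix.smul_apply,
    Matrix.diagonal_apply]
  simp only [(finSplit hq).injective.eq_iff]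
  rcases a with a | a <;> rcases b with b | b <;>
    simp [Matrix.diagonal_apply, finSplit_inl, val_finSplit_inr]
  split_ifs <;> simp

theorem blockExt_mem_siegel {n q : ℕ} (hq : q ≤ n) {Z : Matrix (Fin q) (Fin q) ℂ}
    (hZ : Z ∈ siegel q) {c : ℂ} (hc : 0 < c.im) : blockExt hq Z c ∈ siegel n := by
  refine ⟨?_, ?_⟩
  · rw [blockExt, Matrix.transpose_reindex, Matrix.fromBlocks_transpose, hZ.1]
    simp
  · rw [blockExt_map_im]
    exact blockExt_posDef hq hZ.2 hc

theorem blockExt_submatrix {n q : ℕ} {R : Type} [CommRing R] (hq : q ≤ n)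
    (Z : Matrix (Fin q) (Fin q) R) (c : R) :
    (blockExt hq Z c).submatrix (Fin.castLE hq) (Fin.castLE hq) = Z := by
  ext a b
  rw [Matrix.submatrix_apply, ← finSplit_inl, ← finSplit_inl, blockExt_finSplit,
    Matrix.fromBlocks_apply₁₁]

theorem tauMat_blockExt {n q : ℕ} (hq : q ≤ n) (Z : Matrix (Fin q) (Fin q) ℂ) (t : ℝ) :
    tauMat (blockExt hq Z (Complex.I * t)) = blockExt hq (tauMat Z) (Complex.I * t) := by
  refine ext_finSplit hq fun a b => ?_
  rw [tauMat, Matrix.map_apply, blockExt_finSplit, blockExt_finSplit]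
  rcases a with a | a <;> rcases b with b | b <;> simp [tauMat, Matrix.diagonal_apply]
  split_ifs <;> simp

/-- `j_r²` acts as conjugation of `W` by the sign matrix `ε`, which is the identity on the `Z`-block
since `q ≤ r`, and diagonal on the scalar block; so `ε` commutes with `W`. -/
theorem jmat_mul_self_smul_incl {n q r : ℕ} (hqr : q ≤ r) (hq : q ≤ n) (W : siegel n)
    (Z : Matrix (Fin q) (Fin q) ℂ) (c : ℂ) (hW : W.1 = blockExt hq Z c) :
    (jmat n r * jmat n r) • incl W = incl W := by
  let ε : Fin n → ℂ := fun i => if (i : ℕ) < r then 1 else -1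
  have hcomm : Matrix.diagonal ε * W.1 = W.1 * Matrix.diagonal ε := by
    rw [hW]
    refine ext_finSplit hq fun a b => ?_
    rw [Matrix.diagonal_mul, Matrix.mul_diagonal, blockExt_finSplit]
    rcases a with a | a <;> rcases b with b | b
    · have h1 : ∀ a : Fin q, ε (finSplit hq (Sum.inl a)) = 1 := fun a =>
        if_pos (a.2.trans_le hqr)
      rw [h1, h1, one_mul, mul_one]
    · simp
    · simp
    · by_cases hab : a = b
      · rw [hab, mul_comm]
      · simp [Matrix.diagonal_apply_ne _ hab]
  have hmap : (jmat n r * jmat n r).1.map (Int.cast : ℤ → ℂ) =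
      Matrix.fromBlocks (Matrix.diagonal ε) 0 0 (Matrix.diagonal ε) := by
    have h1 : (fun m : Fin n => ((if (m : ℕ) < r then 1 else -1 : ℤ) : ℂ)) = ε := by
      funext i
      simp only [ε]
      split_ifs <;> simp
    rw [jmat_mul_self, Matrix.fromBlocks_map, Matrix.diagonal_map (by simp)]
    simp only [h1]
    simp
  refine smul_phi_eq_self le_rfl _ W fun v hv => mem_lagr_self.2 ?_
  rw [hmap, Matrix.fromBlocks_mulVec, Sum.elim_comp_inl, Sum.elim_comp_inr, mem_lagr_self.1 hv]
  simp [Matrix.mulVec_mulVec, hcomm]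

/-! ### Real points of boundary components -/

theorem smul_mem_closure {n q : ℕ} (hq : q ≤ n) (g : Sp n ℤ) (Z : siegel q) {S : Set (Hbar n)}
    (hS : ∀ (t : ℝ) (ht : 0 < t), g • incl ⟨blockExt hq Z.1 (Complex.I * t),
      blockExt_mem_siegel hq Z.2 (by simpa using ht)⟩ ∈ S) :
    g • phi hq Z ∈ closure S := by
  rw [mem_closure_iff]
  intro O hO hx
  obtain ⟨U, hU, K, h⟩ := hO (mapSp (Int.castRingHom ℚ) g) q hq Z hx
  -- The parameter must exceed `K` to enter the neighbourhood and be positive to stay in `𝔥_n`.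
  have ht : 0 < max K 0 + 1 := by positivity
  refine ⟨_, h (incl ⟨blockExt hq Z.1 (Complex.I * (max K 0 + 1 : ℝ)),
      blockExt_mem_siegel hq Z.2 (by simpa using ht)⟩)
    ⟨1, ?_, n, hq, le_rfl, _, ?_, ?_, (one_smul _ _).symm⟩, hS _ ht⟩
  · refine ⟨fun i j => ?_, ?_⟩
    · have hne : ∀ {i j : Fin n}, (i : ℕ) ≠ j → i ≠ j := fun h h' => h (congrArg Fin.val h')
      simp only [Submonoid.coe_one, ne_eq, reduceCtorEq, not_false_eq_true,
        Matrix.one_apply_ne, implies_true, true_and]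
      exact ⟨fun h h' => Matrix.one_apply_ne fun e => hne (by omega) (Sum.inl_injective e),
        fun h h' => Matrix.one_apply_ne fun e => hne (by omega) (Sum.inr_injective e)⟩
    · rw [nu, Submonoid.coe_one]
      exact Matrix.submatrix_one _ ((Fin.castLE_injective hq).sumMap (Fin.castLE_injective hq))
  · change (blockExt hq Z.1 _).submatrix (Fin.castLE hq) (Fin.castLE hq) ∈ U
    rw [blockExt_submatrix]
    exact mem_of_mem_nhds hU
  · rw [blockExt_map_im, blockExt_sub_diagonal]
    refine blockExt_posDef hq Z.2.2 ?_
    have : K ≤ max K 0 := le_max_left _ _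
    simp only [Complex.mul_im, Complex.I_re, Complex.ofReal_im, Complex.I_im, Complex.ofReal_re]
    linarith

/-- The right-hand side does not involve `γ`: once `τ(g)⁻¹ γ g` fixes `F_q` pointwise, reality of `g
φ(Z)` only asks that `Z` be purely imaginary. Two such elements therefore have the same real points.
-/
theorem realPts_image_stdF {n q : ℕ} (hq : q ≤ n) (g γ : Sp n ℤ)
    (hu : ∀ Z : siegel q, ((tau g)⁻¹ * γ * g) • phi hq Z = phi hq Z) :
    realPts ((fun x => g • x) '' stdF hq) γ =
      {x | ∃ Z : siegel q, tauMat Z.1 = Z.1 ∧ x = g • phi hq Z} := by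
  have key : ∀ Z : siegel q, tauH (g • phi hq Z) = γ • g • phi hq Z ↔ tauMat Z.1 = Z.1 := by
    intro Z
    have h1 : γ • g • phi hq Z = tau g • phi hq Z := by
      conv_rhs => rw [← hu Z]
      rw [smul_smul, smul_smul]
      congr 1
      group
    rw [tauH_smul_int, h1, smul_left_cancel_iff, tauH_phi, (phi_injective hq).eq_iff,
      Subtype.ext_iff]
  ext x
  constructor
  · rintro ⟨⟨_, ⟨Z, rfl⟩, rfl⟩, h⟩
    exact ⟨Z, (key Z).1 h, rfl⟩
  · rintro ⟨Z, hZ, rfl⟩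
    exact ⟨⟨_, ⟨Z, rfl⟩, rfl⟩, (key Z).2 hZ⟩

theorem tau_mul {n : ℕ} (g h : Sp n ℤ) : tau (g * h) = tau g * tau h := by
  apply Subtype.ext
  rw [Submonoid.coe_mul, coe_tau, coe_tau, coe_tau, Submonoid.coe_mul]
  have := Iminus_mul_self n ℤ
  calc _ = Iminus n ℤ * g.1 * (1 : Matrix _ _ ℤ) * h.1 * Iminus n ℤ := by noncomm_ring
    _ = _ := by
      rw [← this]
      noncomm_ring

theorem proj_mem_VR {n N : ℕ} {γ : Sp n ℤ} (hγ : γ ∈ Gam n N) {x : Hbar n}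
    (hx : tauH x = γ • x) : proj N x ∈ VR n N :=
  Quotient.sound (s := MulAction.orbitRel (Gam n N) (Hbar n)) ⟨⟨γ, hγ⟩, hx.symm⟩

theorem proj_image_closure_subset {n N : ℕ} {ω : Sp n ℤ} (hω : ω ∈ Gam n N) :
    proj N '' closure (incl '' realLocus ω) ⊆ closure (XR n N) := by
  have hc : Continuous (proj (n := n) N) := continuous_quotient_mk'
  refine (image_closure_subset_closure_image hc).trans (closure_mono ?_)
  rintro _ ⟨_, ⟨W, hW, rfl⟩, rfl⟩
  exact ⟨⟨W, rfl⟩, proj_mem_VR hω ((mem_realLocus_iff ω W).1 hW)⟩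

end Satake

theorem mainTheorem12 (n m q r : ℕ) (hm : 1 ≤ m) (hqr : q ≤ r) (hrn : r ≤ n)
    (F : Set (Hbar n)) (γ g : Sp n ℤ)
    (hFγ : IsRealBoundaryPair m (hqr.trans hrn) F γ)
    (hgF : (fun x => g • x) '' stdF (hqr.trans hrn) = F)
    (hu : (tau g)⁻¹ * γ * g ∈ kerNu (hqr.trans hrn))
    (hj : jmat n r * ((tau g)⁻¹ * γ * g) * jmat n r ∈ Gam n (4 * m)) :
    let ω : Sp n ℤ := tau (g * jmat n r) * (g * jmat n r)⁻¹
    ω ∈ Gam n (4 * m) ∧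
    realPts F γ = realPts F ω ∧
    realPts F ω ⊆ closure (incl '' realLocus ω) ∧
    proj (4 * m) '' realPts F γ ⊆ XRclosure n (4 * m) := by
  intro ω
  have hq : q ≤ n := hqr.trans hrn
  have hω : ω = tau g * (jmat n r * jmat n r)⁻¹ * g⁻¹ := by
    simp only [ω, tau_mul, tau_jmat]
    group
  have hωΓ : ω ∈ Gam n (4 * m) := by
    have hn : (Gam n (4 * m)).Normal := MonoidHom.normal_ker _
    -- This conjugate is `τ(g) j⁻² u⁻¹ τ(g)⁻¹ = ω γ⁻¹`.
    have h1 := hn.conj_mem _ (inv_mem hj) (tau g * (jmat n r)⁻¹)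
    convert mul_mem h1 hFγ.mem using 1
    rw [hω]
    group
  have hd : ∀ Z : siegel q, ((tau g)⁻¹ * ω * g) • phi hq Z = phi hq Z := by
    intro Z
    have : (tau g)⁻¹ * ω * g = (jmat n r * jmat n r)⁻¹ := by
      rw [hω]
      group
    rw [this, inv_smul_eq_iff, kerNu_smul_phi hq (jmat_mul_self_mem_kerNu hqr hq)]
  have hFω : realPts F γ = realPts F ω := by
    rw [← hgF, realPts_image_stdF hq g γ (kerNu_smul_phi hq hu), realPts_image_stdF hq g ω hd]
  have hcl : realPts F ω ⊆ closure (incl '' realLocus ω) := by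
    rw [← hgF, realPts_image_stdF hq g ω hd]
    rintro _ ⟨Z, hZ, rfl⟩
    refine smul_mem_closure hq g Z fun t ht => ?_
    rw [smul_incl]
    refine ⟨_, (mem_realLocus_iff _ _).2 ?_, rfl⟩
    set W : siegel n := ⟨blockExt hq Z.1 (Complex.I * t),
      blockExt_mem_siegel hq Z.2 (by simpa using ht)⟩
    have hτ : tauH (incl W) = incl W :=
      (tauH_phi le_rfl W).trans (congrArg incl (Subtype.ext
        ((tauMat_blockExt hq Z.1 t).trans (by rw [hZ]))))
    -- With `W` fixed by `τ` and by `j⁻²`, both `τ(g W)` and `ω g W = τ(g) j⁻² W` reduce to `τ(g)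
    -- W`.
    have hjW := inv_smul_eq_iff.2 (jmat_mul_self_smul_incl hqr hq W Z.1 _ rfl).symm
    rw [← smul_incl, tauH_smul_int, hτ, smul_smul, hω, inv_mul_cancel_right, mul_smul, hjW]
  refine ⟨hωΓ, hFω, hcl, ?_⟩
  rintro _ ⟨x, hx, rfl⟩
  exact ⟨proj_image_closure_subset hωΓ ⟨x, hcl (hFω ▸ hx), rfl⟩, proj_mem_VR hFγ.mem hx.2⟩
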